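/- Let $R$ be a commutative ring with identity. For a finite sequence $\underline{x}=x_1,\dots,x_r$ in $R$ let $\mathbb{K}_\bullet(\underline{x})$ be its Koszul complex and let $H^i_{\underline{x}}(R)$ be the $i$-th cohomology of the Čech complex of $R$ with respect to $\underline{x}$. **Koszul grade.** If an ideal $\mathfrak{b}$ of $R$ is generated by $\underline{x}=x_1,\dots,x_r$, put $\operatorname{K.grade}_R(\mathfrak{b},R)=\inf\{i\ge 0 : H^i(\operatorname{Hom}_R(\mathbb{K}_\bullet(\underline{x}),R))\ne 0\}$, with $\inf\emptyset=+\infty$ (this does not depend on the choice of $\underline{x}$). For an arbitrary ideal $\mathfrak{a}$, $\operatorname{K.grade}_R(\mathfrak{a},R)$ is the supremum of $\operatorname{K.grade}_R(\mathfrak{b},R)$ over the finitely generated ideals $\mathfrak{b}\subseteq\mathfrak{a}$; for finitely generated $\mathfrak{a}$ the two definitions agree. The ring $R$ is *Cohen–Macaulay in the sense of finitely generated ideals* if $\operatorname{ht}(\mathfrak{a})=\operatorname{K.grade}_R(\mathfrak{a},R)$ for every finitely generated ideal $\mathfrak{a}$ of $R$ (where $\operatorname{ht}(R)=+\infty$).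 **Parameter sequences.** Write $\underline{x}^n=x_1^n,\dots,x_r^n$. For $m\ge n$ let $\varphi^m_n(\underline{x}):\mathbb{K}_\bullet(\underline{x}^m)\to\mathbb{K}_\bullet(\underline{x}^n)$ be the chain map $e_{s_1}\wedge\dots\wedge e_{s_i}\mapsto (x_{s_1}\cdots x_{s_i})^{m-n}\,e_{s_1}\wedge\dots\wedge e_{s_i}$. The sequence $\underline{x}$ is *weakly proregular* if for each $n>0$ there is $m\ge n$ such that the maps $H_i(\varphi^m_n(\underline{x})):H_i(\mathbb{K}_\bullet(\underline{x}^m))\to H_i(\mathbb{K}_\bullet(\underline{x}^n))$ are zero for all $i\ge1$. A sequence $\underline{x}=x_1,\dots,x_\ell$ is a *parameter sequence* on $R$ if it is weakly proregular, $(\underline{x})R\neq R$, and $H^\ell_{\underline{x}}(R)_{\mathfrak{p}}\ne0$ for every prime ideal $\mathfrak{p}\supseteq(\underline{x})R$. It is a *strong parameter sequence* on $R$ if $x_1,\dots,x_i$ is a parameter sequence on $R$ for every $1\le i\le\ell$. The ring $R$ is *Cohen–Macaulay in the sense of Hamilton–Marley* if every strong parameter sequence $x_1,\dots,x_\ell$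 ($\ell\ge1$) on $R$ is a regular sequence on $R$, i.e. $x_i$ is a nonzerodivisor on $R/(x_1,\dots,x_{i-1})R$ for $i=1,\dots,\ell$ and $(x_1,\dots,x_\ell)R\ne R$. **Theorem.** If $R$ is Cohen–Macaulay in the sense of finitely generated ideals, then $R$ is Cohen–Macaulay in the sense of Hamilton–Marley. -/

import Mathlib

open CategoryTheory

namespace NonNoetherianCM

universe u

/-! ### Signs -/

/-- The sign `(-1) ^ #{k ∈ S | k < j}` attached to the position of `j` in `S`. -/
def sgn {r : ℕ} (S : Finset (Fin r)) (j : Fin r) : ℤ :=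
  (-1) ^ (S.filter (· < j)).card

theorem sgn_swap_of_lt {r : ℕ} (S : Finset (Fin r)) {j k : Fin r} (hj : j ∈ S) (hlt : j < k) :
    sgn S j * sgn (S.erase j) k = -(sgn S k * sgn (S.erase k) j) := by
  have h1 : ((S.erase j).filter (· < k)) = (S.filter (· < k)).erase j := by
    ext a; simp only [Finset.mem_filter, Finset.mem_erase]; tauto
  have h2 : ((S.erase k).filter (· < j)) = S.filter (· < j) := by
    ext a
    simp only [Finset.mem_filter, Finset.mem_erase]
    constructor
    · tauto
    · rintro ⟨h, h'⟩
      exact ⟨⟨(h'.trans hlt).ne, h⟩, h'⟩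
  have hmem : j ∈ S.filter (· < k) := by simp [hj, hlt]
  have h3 := Finset.card_erase_add_one hmem
  unfold sgn
  rw [h1, h2, ← h3, pow_succ]
  ring

theorem sgn_swap {r : ℕ} (S : Finset (Fin r)) {j k : Fin r} (hj : j ∈ S) (hk : k ∈ S)
    (hne : j ≠ k) :
    sgn S j * sgn (S.erase j) k = -(sgn S k * sgn (S.erase k) j) := by
  rcases lt_or_gt_of_ne hne with h | h
  · exact sgn_swap_of_lt S hj h
  · rw [sgn_swap_of_lt S hk h, neg_neg]

/-- The sum over ordered pairs of distinct elements of `S` of a quantity that changes sign under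
the exchange of the two elements vanishes. -/
theorem sum_pairs_eq_zero {r : ℕ} {A : Type*} [AddCommGroup A] (S : Finset (Fin r))
    (F : (p : (j : S) × (S.erase j.1 : Finset (Fin r))) → A)
    (hF : ∀ (j k : Fin r) (hj : j ∈ S) (hk : k ∈ S) (h : k ∈ S.erase j) (h' : j ∈ S.erase k),
      F ⟨⟨j, hj⟩, ⟨k, h⟩⟩ + F ⟨⟨k, hk⟩, ⟨j, h'⟩⟩ = 0) :
    ∑ j : S, ∑ k : (S.erase j.1 : Finset (Fin r)), F ⟨j, k⟩ = 0 := by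
  rw [← Finset.sum_sigma Finset.univ (fun _ => Finset.univ) F]
  refine Finset.sum_involution
    (fun p _ => ⟨⟨p.2.1, Finset.mem_of_mem_erase p.2.2⟩,
      ⟨p.1.1, Finset.mem_erase.2 ⟨(Finset.ne_of_mem_erase p.2.2).symm, p.1.2⟩⟩⟩) ?_ ?_ ?_ ?_
  · rintro ⟨⟨j, hj⟩, ⟨k, hk⟩⟩ _
    exact hF j k hj _ hk _
  · rintro ⟨⟨j, hj⟩, ⟨k, hk⟩⟩ _ _ heq
    have : k = j := congrArg (fun q => q.1.1) heq
    exact Finset.ne_of_mem_erase hk this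
  · intro p _
    simp
  · rintro ⟨⟨j, hj⟩, ⟨k, hk⟩⟩ _
    rfl

/-! ### The Koszul complex -/

/-- The subsets of `{0, …, r-1}` with `i` elements. -/
abbrev Sub (r i : ℕ) : Type := {S : Finset (Fin r) // S.card = i}

/-- The subset `S` without its element `j`. -/
abbrev Sub.del {r i : ℕ} (S : Sub r (i + 1)) (j : S.1) : Sub r i :=
  ⟨S.1.erase j.1, by rw [Finset.card_erase_of_mem j.2, S.2]; rfl⟩

/-- The differential `K_{i+1}(x) → K_i(x)` of the Koszul complex; `K_i(x) = ⋀^i R^r` is the free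
module on the subsets `S` of size `i`
(the basis vector of `S = {s₁ < ⋯ < sᵢ}` being `e_{s₁} ∧ ⋯ ∧ e_{sᵢ}`). -/
noncomputable def koszulD {R : Type u} [CommRing R] {r : ℕ} (x : Fin r → R) (i : ℕ) :
    (Sub r (i + 1) →₀ R) →ₗ[R] (Sub r i →₀ R) :=
  Finsupp.linearCombination R fun S =>
    ∑ j : S.1, Finsupp.single (S.del j) ((sgn S.1 j.1 : R) * x j.1)

theorem koszulD_single {R : Type u} [CommRing R] {r : ℕ} (x : Fin r → R) (i : ℕ)
    (S : Sub r (i + 1)) (a : R) :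
    koszulD x i (Finsupp.single S a) =
      ∑ j : S.1, Finsupp.single (S.del j) (a * ((sgn S.1 j.1 : R) * x j.1)) := by
  simp only [koszulD, Finsupp.linearCombination_single, Finset.smul_sum, Finsupp.smul_single,
    smul_eq_mul]

theorem koszulD_comp {R : Type u} [CommRing R] {r : ℕ} (x : Fin r → R) (i : ℕ) :
    koszulD x i ∘ₗ koszulD x (i + 1) = 0 := by
  refine Finsupp.lhom_ext fun S a => ?_
  simp only [LinearMap.comp_apply, koszulD_single, map_sum, LinearMap.zero_apply]
  refine sum_pairs_eq_zero S.1 (fun p => Finsupp.single ((S.del p.1).del p.2)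
    (a * ((sgn S.1 p.1.1 : R) * x p.1.1) * ((sgn (S.1.erase p.1.1) p.2.1 : R) * x p.2.1))) ?_
  intro j k hj hk h h'
  have he : (S.del ⟨j, hj⟩).del ⟨k, h⟩ = (S.del ⟨k, hk⟩).del ⟨j, h'⟩ :=
    Subtype.ext (Finset.erase_right_comm)
  have hs := congrArg (Int.cast : ℤ → R)
    (sgn_swap S.1 hj hk (Finset.ne_of_mem_erase h).symm)
  push_cast at hs
  simp only [he]
  rw [← Finsupp.single_add]
  rw [Finsupp.single_eq_zero]
  linear_combination (a * x j * x k) * hs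

/-- The Koszul complex `K_•(x)` of a finite sequence `x` of elements of `R`. -/
noncomputable abbrev koszulComplex {R : Type u} [CommRing R] {r : ℕ} (x : Fin r → R) :
    ChainComplex (ModuleCat.{u} R) ℕ :=
  ChainComplex.of (fun i => ModuleCat.of R (Sub r i →₀ R))
    (fun i => ModuleCat.ofHom (koszulD x i))
    (fun i => by rw [← ModuleCat.ofHom_comp, koszulD_comp]; rfl)

theorem koszulComplex_d {R : Type u} [CommRing R] {r : ℕ} (x : Fin r → R) (i : ℕ) :
    (koszulComplex x).d (i + 1) i = ModuleCat.ofHom (koszulD x i) :=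
  ChainComplex.of_d (fun i => ModuleCat.of R (Sub r i →₀ R))
    (fun i => ModuleCat.ofHom (koszulD x i)) i

/-- The component in degree `i` of the comparison map `K_•(x^m) → K_•(x^n)`: multiplication by
`(∏_{j ∈ S} x_j)^{m-n}` on the basis vector of `S`. -/
noncomputable def koszulPowLin {R : Type u} [CommRing R] {r : ℕ} (x : Fin r → R) (n m i : ℕ) :
    (Sub r i →₀ R) →ₗ[R] (Sub r i →₀ R) :=
  Finsupp.linearCombination R fun S => Finsupp.single S ((∏ j ∈ S.1, x j) ^ (m - n))

theorem koszulPowLin_single {R : Type u} [CommRing R] {r : ℕ} (x : Fin r → R) (n m i : ℕ)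
    (S : Sub r i) (a : R) :
    koszulPowLin x n m i (Finsupp.single S a) =
      Finsupp.single S (a * (∏ j ∈ S.1, x j) ^ (m - n)) := by
  simp [koszulPowLin, Finsupp.linearCombination_single]

theorem koszulPowLin_comm {R : Type u} [CommRing R] {r : ℕ} (x : Fin r → R) {n m : ℕ}
    (h : n ≤ m) (i : ℕ) :
    koszulD (x ^ n) i ∘ₗ koszulPowLin x n m (i + 1) =
      koszulPowLin x n m i ∘ₗ koszulD (x ^ m) i := by
  refine Finsupp.lhom_ext fun S a => ?_
  simp only [LinearMap.comp_apply, koszulD_single, koszulPowLin_single, map_sum]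
  refine Finset.sum_congr rfl fun j _ => ?_
  congr 1
  obtain ⟨c, rfl⟩ := Nat.exists_eq_add_of_le h
  have hp : x j.1 * ∏ k ∈ S.1.erase j.1, x k = ∏ k ∈ S.1, x k :=
    Finset.mul_prod_erase S.1 x j.2
  simp only [Pi.pow_apply, Nat.add_sub_cancel_left, ← hp, mul_pow, pow_add]
  ring

/-- The comparison map `φ^m_n(x) : K_•(x^m) → K_•(x^n)` for `n ≤ m`, i.e. the tensor product over
`j` of the maps `K_•(x_j^m) → K_•(x_j^n)` that are the identity in degree `0` and multiplication
by `x_j^{m-n}` in degree `1`. -/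
noncomputable def koszulPowMap {R : Type u} [CommRing R] {r : ℕ} (x : Fin r → R) {n m : ℕ}
    (h : n ≤ m) : koszulComplex (x ^ m) ⟶ koszulComplex (x ^ n) :=
  ChainComplex.ofHom (fun i => ModuleCat.ofHom (koszulPowLin x n m i))
    (fun i => by
      rw [koszulComplex_d, koszulComplex_d, ← ModuleCat.ofHom_comp, ← ModuleCat.ofHom_comp,
        koszulPowLin_comm x h])

/-! ### The Koszul grade -/

/-- The Koszul cohomology `H^i(Hom_R(K_•(x), M))`. -/
noncomputable abbrev koszulCohomology {R : Type u} [CommRing R] {r : ℕ} (x : Fin r → R)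
    (M : Type u) [AddCommGroup M] [Module R M] (i : ℕ) : ModuleCat.{u} R :=
  ((koszulComplex x).linearYonedaObj R (ModuleCat.of R M)).homology i

/-- `inf {i | H^i(Hom_R(K_•(x), M)) ≠ 0}`, with `inf ∅ = ∞`: the Koszul grade on `M` of the ideal
generated by the finite sequence `x`. -/
noncomputable def koszulGradeSeq {R : Type u} [CommRing R] {r : ℕ} (x : Fin r → R)
    (M : Type u) [AddCommGroup M] [Module R M] : ℕ∞ :=
  ⨅ (i : ℕ) (_ : Nontrivial (koszulCohomology x M i)), (i : ℕ∞)

/-- The Koszul grade of an arbitrary ideal `𝔞` on `M`: the supremum of the Koszul grades of the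
finitely generated subideals of `𝔞`, each presented by a finite generating sequence `x`. -/
noncomputable def koszulGrade {R : Type u} [CommRing R] (𝔞 : Ideal R)
    (M : Type u) [AddCommGroup M] [Module R M] : ℕ∞ :=
  ⨆ (r : ℕ) (x : Fin r → R) (_ : Ideal.span (Set.range x) ≤ 𝔞), koszulGradeSeq x M

/-! ### The Čech complex -/

/-- The canonical map `R_a → R_b` for `a ∣ b`. -/
noncomputable def awayMap {R : Type u} [CommRing R] {a b : R} (h : a ∣ b) :
    Localization.Away a →ₐ[R] Localization.Away b :=
  IsLocalization.liftAlgHom (M := Submonoid.powers a)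
    (f := Algebra.ofId R (Localization.Away b)) (by
      rintro ⟨_, n, rfl⟩
      have hb : IsUnit (algebraMap R (Localization.Away b) b) :=
        IsLocalization.Away.algebraMap_isUnit b
      have ha : IsUnit (algebraMap R (Localization.Away b) a) :=
        isUnit_of_dvd_unit (map_dvd _ h) hb
      simpa [Algebra.ofId_apply] using ha.pow n)

theorem awayMap_comp {R : Type u} [CommRing R] {a b c : R} (h : a ∣ b) (h' : b ∣ c)
    (z : Localization.Away a) : awayMap h' (awayMap h z) = awayMap (h.trans h') z := by
  have : (awayMap h').comp (awayMap h) = awayMap (h.trans h') :=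
    IsLocalization.algHom_ext (W := Submonoid.powers a) (A := R) (by ext)
  exact DFunLike.congr_fun this z

/-- The Čech cochains of degree `i`: the product of the localizations `R_{x_S}`, `x_S = ∏_{j ∈ S}
x_j`, over the subsets `S` of size `i`. -/
abbrev CechCochain {R : Type u} [CommRing R] {r : ℕ} (x : Fin r → R) (i : ℕ) : Type u :=
  (S : Sub r i) → Localization.Away (∏ j ∈ S.1, x j)

/-- The Čech differential
`(d f)_T = ∑_{j ∈ T} (-1)^{#{k ∈ T | k < j}} (image of f_{T ∖ j} in R_{x_T})`. -/
noncomputable def cechD {R : Type u} [CommRing R] {r : ℕ} (x : Fin r → R) (i : ℕ) :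
    CechCochain x i →ₗ[R] CechCochain x (i + 1) :=
  LinearMap.pi fun T => ∑ j : T.1, sgn T.1 j.1 •
    ((awayMap (Finset.prod_dvd_prod_of_subset (T.del j).1 T.1 x
      (Finset.erase_subset j.1 T.1))).toLinearMap ∘ₗ LinearMap.proj (T.del j))

theorem cechD_apply {R : Type u} [CommRing R] {r : ℕ} (x : Fin r → R) (i : ℕ)
    (f : CechCochain x i) (T : Sub r (i + 1)) :
    cechD x i f T = ∑ j : T.1, sgn T.1 j.1 •
      awayMap (Finset.prod_dvd_prod_of_subset (T.del j).1 T.1 x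
        (Finset.erase_subset j.1 T.1)) (f (T.del j)) := by
  simp [cechD, LinearMap.sum_apply]

theorem cechD_comp {R : Type u} [CommRing R] {r : ℕ} (x : Fin r → R) (i : ℕ) :
    cechD x (i + 1) ∘ₗ cechD x i = 0 := by
  refine LinearMap.ext fun f => funext fun T => ?_
  simp only [LinearMap.comp_apply, cechD_apply, map_sum, map_zsmul, awayMap_comp,
    Finset.smul_sum, smul_smul, LinearMap.zero_apply, Pi.zero_apply]
  refine sum_pairs_eq_zero T.1 (fun p => (sgn T.1 p.1.1 * sgn (T.1.erase p.1.1) p.2.1) •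
    awayMap (Finset.prod_dvd_prod_of_subset ((T.del p.1).del p.2).1 T.1 x
      ((Finset.erase_subset _ _).trans (Finset.erase_subset _ _)))
      (f ((T.del p.1).del p.2))) ?_
  intro j k hj hk h h'
  have he : (T.del ⟨j, hj⟩).del ⟨k, h⟩ = (T.del ⟨k, hk⟩).del ⟨j, h'⟩ :=
    Subtype.ext (Finset.erase_right_comm)
  have key : ∀ (U V : Sub r i) (hU : U.1 ⊆ T.1) (hV : V.1 ⊆ T.1), U = V →
      awayMap (Finset.prod_dvd_prod_of_subset U.1 T.1 x hU) (f U) =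
        awayMap (Finset.prod_dvd_prod_of_subset V.1 T.1 x hV) (f V) := by
    rintro U V hU hV rfl; rfl
  have hs := sgn_swap T.1 hj hk (Finset.ne_of_mem_erase h).symm
  have hsub : ∀ a b : Fin r, (T.1.erase a).erase b ⊆ T.1 := fun a b =>
    (Finset.erase_subset _ _).trans (Finset.erase_subset _ _)
  dsimp only
  rw [key _ _ (hsub j k) (hsub k j) he, hs, neg_smul, neg_add_cancel]

/-- The Čech complex of `R` with respect to the finite sequence `x`. -/
noncomputable abbrev cechComplex {R : Type u} [CommRing R] {r : ℕ} (x : Fin r → R) :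
    CochainComplex (ModuleCat.{u} R) ℕ :=
  CochainComplex.of (fun i => ModuleCat.of R (CechCochain x i))
    (fun i => ModuleCat.ofHom (cechD x i))
    (fun i => by rw [← ModuleCat.ofHom_comp, cechD_comp]; rfl)

/-- The Čech cohomology `H^i_x(R)`. -/
noncomputable abbrev cechCohomology {R : Type u} [CommRing R] {r : ℕ} (x : Fin r → R) (i : ℕ) :
    ModuleCat.{u} R :=
  (cechComplex x).homology i

/-! ### Parameter sequences and Cohen-Macaulay rings -/

/-- `x` is weakly proregular: for each `n > 0` there is `m ≥ n` such that
`H_i(φ^m_n(x)) : H_i(K_•(x^m)) → H_i(K_•(x^n))` vanishes for all `i ≥ 1`. -/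
def IsWeaklyProregular {R : Type u} [CommRing R] {r : ℕ} (x : Fin r → R) : Prop :=
  ∀ n : ℕ, 0 < n → ∃ (m : ℕ) (h : n ≤ m), ∀ i : ℕ, 1 ≤ i →
    HomologicalComplex.homologyMap (koszulPowMap x h) i = 0

/-- Parameter sequences on `R`. -/
structure IsParameterSequence {R : Type u} [CommRing R] {r : ℕ} (x : Fin r → R) : Prop where
  weaklyProregular : IsWeaklyProregular x
  ne_top : Ideal.span (Set.range x) ≠ ⊤
  nontrivial_localization : ∀ (p : Ideal R) [p.IsPrime], Ideal.span (Set.range x) ≤ p →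
    Nontrivial (LocalizedModule p.primeCompl (cechCohomology x r))

/-- Strong parameter sequences on `R`: every initial segment `x₁, …, xᵢ` with `1 ≤ i ≤ r` is a
parameter sequence. -/
def IsStrongParameterSequence {R : Type u} [CommRing R] {r : ℕ} (x : Fin r → R) : Prop :=
  ∀ (i : ℕ) (h : i ≤ r), 1 ≤ i → IsParameterSequence fun k : Fin i => x (Fin.castLE h k)

/-- `R` is Cohen-Macaulay in the sense of Hamilton-Marley: every strong parameter sequence
`x₁, …, x_r` (`r ≥ 1`) is a regular sequence on `R`. -/
def IsCohenMacaulayHM (R : Type u) [CommRing R] : Prop :=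
  ∀ (r : ℕ) (x : Fin r → R), 1 ≤ r → IsStrongParameterSequence x →
    RingTheory.Sequence.IsRegular R (List.ofFn x)

/-- `R` is Cohen-Macaulay in the sense of a class `𝒜` of ideals: height and Koszul grade on `R`
agree for every ideal in `𝒜`. -/
def IsCohenMacaulayFor (R : Type u) [CommRing R] (𝒜 : Set (Ideal R)) : Prop :=
  ∀ 𝔞 ∈ 𝒜, 𝔞.height = koszulGrade 𝔞 R

end NonNoetherianCM

/-! Let `x` be a parameter sequence of length `ℓ`. If a prime `p ⊇ (x)` had height below `ℓ`, then
`R_p` would have dimension below `ℓ`, and a monomial relation `(x₁⋯x_ℓ)^m ∈ (x₁^(m+1), …,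
x_ℓ^(m+1))` in `R_p`, applied to powers of the `xᵢ`, would annihilate the top Čech cohomology at
`p`. Hence `ht (x) ≥ ℓ` (`IsParameterSequence.le_height`). By hypothesis the Koszul grade of `(x)`
is then at least `ℓ`, so the Koszul cohomology of `x` itself vanishes below `ℓ`
(`acyclicAt_of_le_koszulGrade`, resting on `AcyclicAt.of_span_le`). Degree `ℓ - 1` is dual to `H₁`:
its vanishing makes all syzygies of `x` trivial, so `x_ℓ` is a nonzerodivisor modulo its
predecessors (`AcyclicAt.mem_span_of_mul_mem`). Applying this to every initial segment gives
regularity. -/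

namespace NonNoetherianCM

universe u

/-! ### Koszul cochains -/

section Cochains

variable {R : Type u} [CommRing R] {r : ℕ}

/-- The differential of the Koszul cochain complex of `x`, a cochain being regarded as a function
on all sets of indices. -/
def cochainD (x : Fin r → R) : (Finset (Fin r) → R) →ₗ[R] (Finset (Fin r) → R) where
  toFun f T := ∑ j ∈ T, (sgn T j : R) * x j * f (T.erase j)
  map_add' f g := by
    ext T
    simp only [Pi.add_apply, mul_add, Finset.sum_add_distrib]
  map_smul' c f := by
    ext T
    simp only [Pi.smul_apply, smul_eq_mul, RingHom.id_apply, Finset.mul_sum]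
    exact Finset.sum_congr rfl fun j _ => by ring

theorem cochainD_apply (x : Fin r → R) (f : Finset (Fin r) → R) (T : Finset (Fin r)) :
    cochainD x f T = ∑ j ∈ T, (sgn T j : R) * x j * f (T.erase j) := rfl

theorem sgn_mul_self (S : Finset (Fin r)) (j : Fin r) : (sgn S j : R) * sgn S j = 1 := by
  unfold sgn
  push_cast
  rw [← mul_pow, neg_one_mul, neg_neg, one_pow]

theorem cochainD_congr (x : Fin r → R) {f g : Finset (Fin r) → R} {T : Finset (Fin r)}
    (h : ∀ j ∈ T, f (T.erase j) = g (T.erase j)) : cochainD x f T = cochainD x g T :=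
  Finset.sum_congr rfl fun j hj => by rw [h j hj]

/-- The contraction of the cochain `f` with the basis vector `p`. -/
def contract (p : Fin r) (f : Finset (Fin r) → R) (S : Finset (Fin r)) : R :=
  if p ∈ S then 0 else (sgn (insert p S) p : R) * f (insert p S)

theorem contract_of_notMem {p : Fin r} (f : Finset (Fin r) → R) {S : Finset (Fin r)}
    (h : p ∉ S) : contract p f S = (sgn (insert p S) p : R) * f (insert p S) := if_neg h

/-- Cartan formula `ι_p d + d ι_p = x_p`: contraction with `p` is a null-homotopy of multiplication
by `x_p`. -/
theorem sgn_mul_cochainD_insert (x : Fin r → R) (f : Finset (Fin r) → R) {p : Fin r}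
    {S : Finset (Fin r)} (hp : p ∉ S) :
    (sgn (insert p S) p : R) * cochainD x f (insert p S) =
      x p * f S - cochainD x (contract p f) S := by
  rw [cochainD_apply, Finset.sum_insert hp, Finset.erase_insert hp, mul_add, ← mul_assoc,
    ← mul_assoc, sgn_mul_self, one_mul, sub_eq_add_neg, cochainD_apply, Finset.mul_sum,
    ← Finset.sum_neg_distrib]
  congr 1
  refine Finset.sum_congr rfl fun j hj => ?_
  have hne : j ≠ p := fun h => hp (h ▸ hj)
  have hp' : p ∉ S.erase j := fun h => hp (Finset.mem_of_mem_erase h)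
  have hs := congrArg (Int.cast : ℤ → R) (sgn_swap (insert p S) (Finset.mem_insert_self p S)
    (Finset.mem_insert_of_mem hj) hne.symm)
  push_cast at hs
  rw [Finset.erase_insert hp, Finset.erase_insert_of_ne hne.symm] at hs
  rw [contract_of_notMem f hp', Finset.erase_insert_of_ne hne.symm]
  have h1 := sgn_mul_self (R := R) (insert p S) j
  have h2 := sgn_mul_self (R := R) S j
  -- Removing `p` and `j` in the two orders gives opposite signs; signs square to one.
  have key : (sgn (insert p S) p : R) * sgn (insert p S) j =
      -((sgn S j : R) * sgn (insert p (S.erase j)) p) := by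
    linear_combination (sgn S j * sgn (insert p S) j : R) * hs
      - (sgn (insert p S) p * sgn (insert p S) j : R) * h2
      - (sgn S j * sgn (insert p (S.erase j)) p : R) * h1
  linear_combination (x j * f (insert p (S.erase j))) * key

/-- The cochain that restricts to `f` on the sets without `p`, and whose contraction with `p`
is `u`. -/
def glue (p : Fin r) (f u : Finset (Fin r) → R) (S : Finset (Fin r)) : R :=
  if p ∈ S then (sgn S p : R) * u (S.erase p) else f S

theorem glue_of_notMem {p : Fin r} (f u : Finset (Fin r) → R) {S : Finset (Fin r)} (h : p ∉ S) :
    glue p f u S = f S := if_neg h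

theorem contract_glue {p : Fin r} (f u : Finset (Fin r) → R) {S : Finset (Fin r)} (h : p ∉ S) :
    contract p (glue p f u) S = u S := by
  rw [contract_of_notMem _ h, glue, if_pos (Finset.mem_insert_self p S), Finset.erase_insert h,
    ← mul_assoc, sgn_mul_self, one_mul]

theorem cochainD_glue_of_notMem (x : Fin r → R) {p : Fin r} (f u : Finset (Fin r) → R)
    {S : Finset (Fin r)} (h : p ∉ S) : cochainD x (glue p f u) S = cochainD x f S :=
  cochainD_congr x fun _ _ => glue_of_notMem f u fun h' => h (Finset.mem_of_mem_erase h')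

/-- The complex on `insert p A` is the mapping cone, up to shift, of `x_p` on the complex on `A`;
this is the cone differential in the `p`-component. -/
theorem sgn_mul_cochainD_glue_insert (x : Fin r → R) {p : Fin r} (f u : Finset (Fin r) → R)
    {S : Finset (Fin r)} (h : p ∉ S) :
    (sgn (insert p S) p : R) * cochainD x (glue p f u) (insert p S) =
      x p * f S - cochainD x u S := by
  rw [sgn_mul_cochainD_insert x _ h, glue_of_notMem f u h]
  congr 1
  exact cochainD_congr x fun _ _ => contract_glue f u fun h' => h (Finset.mem_of_mem_erase h')

theorem eq_of_sgn_mul_eq {S : Finset (Fin r)} {p : Fin r} {a b : R}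
    (h : (sgn S p : R) * a = sgn S p * b) : a = b := by
  have := congrArg ((sgn S p : R) * ·) h
  simpa only [← mul_assoc, sgn_mul_self, one_mul] using this

/-! ### Vanishing of Koszul cohomology under enlarging and shrinking the family -/

/-- The Koszul cohomology of the subfamily of `x` indexed by `A` vanishes in degree `i`. -/
def AcyclicAt (x : Fin r → R) (A : Finset (Fin r)) (i : ℕ) : Prop :=
  ∀ f : Finset (Fin r) → R, (∀ T ⊆ A, T.card = i + 1 → cochainD x f T = 0) →
    ∃ g : Finset (Fin r) → R, ∀ S ⊆ A, S.card = i → f S = cochainD x g S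

/-- The long exact sequence of the cone, done by hand: with `f = d g₀` on `A`, the defect `x_p g₀ -
ι_p f` is a cocycle one degree lower, and its primitive `u` supplies the `p`-component. -/
theorem acyclicAt_insert {x : Fin r → R} {A : Finset (Fin r)} {p : Fin r} (hp : p ∉ A) {ℓ : ℕ}
    (h : ∀ i < ℓ, AcyclicAt x A i) : ∀ i < ℓ, AcyclicAt x (insert p A) i := by
  intro i hi f hf
  obtain ⟨g₀, hg₀⟩ := h i hi f fun T hT hc => hf T (hT.trans (Finset.subset_insert p A)) hc
  have hins : ∀ S ⊆ A, S.card = i → x p * f S = cochainD x (contract p f) S := by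
    intro S hS hc
    have hpS : p ∉ S := fun h' => hp (hS h')
    have := sgn_mul_cochainD_insert x f hpS
    rw [hf _ (Finset.insert_subset_insert p hS) (by rw [Finset.card_insert_of_notMem hpS, hc]),
      mul_zero] at this
    exact (sub_eq_zero.1 this.symm)
  have hh : ∃ u : Finset (Fin r) → R, ∀ S ⊆ A, S.card + 1 = i →
      (x p • g₀ - contract p f) S = cochainD x u S := by
    cases i with
    -- In degree `0` there is no lower degree, so the condition is vacuous.
    | zero => exact ⟨0, fun S _ hc => absurd hc (Nat.succ_ne_zero _)⟩
    | succ i =>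
      obtain ⟨u, hu⟩ := h i (i.lt_succ_self.trans hi) (x p • g₀ - contract p f) fun T hT hc => by
        rw [map_sub, map_smul, Pi.sub_apply, Pi.smul_apply, smul_eq_mul, ← hg₀ T hT hc,
          hins T hT hc, sub_self]
      exact ⟨u, fun S hS hc => hu S hS (Nat.succ.inj hc)⟩
  obtain ⟨u, hu⟩ := hh
  refine ⟨glue p g₀ u, fun S hS hc => ?_⟩
  by_cases hpS : p ∈ S
  · have hpS' : p ∉ S.erase p := Finset.notMem_erase p S
    have hSA : S.erase p ⊆ A := fun a ha =>
      (Finset.mem_insert.1 (hS (Finset.mem_of_mem_erase ha))).resolve_left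
        (Finset.ne_of_mem_erase ha)
    have h1 := hu _ hSA (by rw [Finset.card_erase_add_one hpS, hc])
    rw [Pi.sub_apply, contract_of_notMem f hpS', Pi.smul_apply, smul_eq_mul] at h1
    have h2 := sgn_mul_cochainD_glue_insert x g₀ u hpS'
    rw [← h1, sub_sub_cancel, Finset.insert_erase hpS] at h2
    exact (eq_of_sgn_mul_eq h2).symm
  · rw [cochainD_glue_of_notMem x g₀ u hpS]
    exact hg₀ S ((Finset.subset_insert_iff_of_notMem hpS).1 hS) hc

/-- The ideal generated by the family annihilates its Koszul cohomology: contractions handle the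
generators, and the claim is linear in `z`. -/
theorem exists_cochainD_eq_mul {x : Fin r → R} {A : Finset (Fin r)} {i : ℕ}
    {f : Finset (Fin r) → R} (hf : ∀ T ⊆ A, T.card = i + 1 → cochainD x f T = 0) {z : R}
    (hz : z ∈ Ideal.span (x '' A)) :
    ∃ u : Finset (Fin r) → R, ∀ S ⊆ A, S.card = i → z * f S = cochainD x u S := by
  induction hz using Submodule.span_induction with
  | mem z hz =>
    obtain ⟨j, hj, rfl⟩ := hz
    refine ⟨contract j f, fun S hS hc => ?_⟩
    -- For `j ∈ S`, the contraction vanishes on sets containing `j`, so only the `j`-term of the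
    -- differential survives; otherwise the Cartan formula with `d f = 0` applies.
    by_cases hjS : j ∈ S
    · rw [cochainD_apply, Finset.sum_eq_single_of_mem j hjS]
      · rw [contract_of_notMem f (Finset.notMem_erase j S), Finset.insert_erase hjS]
        linear_combination (-(x j * f S)) * sgn_mul_self (R := R) S j
      · intro k _ hk
        rw [contract, if_pos (Finset.mem_erase.2 ⟨hk.symm, hjS⟩), mul_zero]
    · have := sgn_mul_cochainD_insert x f hjS
      rw [hf _ (Finset.insert_subset hj hS) (by rw [Finset.card_insert_of_notMem hjS, hc]),
        mul_zero] at this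
      exact sub_eq_zero.1 this.symm
  | zero => exact ⟨0, fun S _ _ => by simp⟩
  | add a b _ _ ha hb =>
    obtain ⟨u, hu⟩ := ha
    obtain ⟨v, hv⟩ := hb
    exact ⟨u + v, fun S hS hc => by
      rw [map_add, Pi.add_apply, ← hu S hS hc, ← hv S hS hc, add_mul]⟩
  | smul c a _ ha =>
    obtain ⟨u, hu⟩ := ha
    exact ⟨c • u, fun S hS hc => by
      rw [map_smul, Pi.smul_apply, ← hu S hS hc, smul_eq_mul, smul_eq_mul, mul_assoc]⟩

/-- Since `x_p` annihilates the cohomology on `A`, write `x_p f = d u`; then `glue p f u` is a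
cocycle extending `f`, and a primitive of it restricts to one of `f`. -/
theorem AcyclicAt.of_insert {x : Fin r → R} {A : Finset (Fin r)} {p : Fin r} (hp : p ∉ A)
    (hx : x p ∈ Ideal.span (x '' A)) {i : ℕ} (h : AcyclicAt x (insert p A) i) :
    AcyclicAt x A i := by
  intro f hf
  obtain ⟨u, hu⟩ := exists_cochainD_eq_mul hf hx
  obtain ⟨g, hg⟩ := h (glue p f u) fun T hT hc => by
    by_cases hpT : p ∈ T
    · have hpT' : p ∉ T.erase p := Finset.notMem_erase p T
      have hTA : T.erase p ⊆ A := fun a ha =>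
        (Finset.mem_insert.1 (hT (Finset.mem_of_mem_erase ha))).resolve_left
          (Finset.ne_of_mem_erase ha)
      have h2 := sgn_mul_cochainD_glue_insert x f u hpT'
      rw [hu _ hTA (by rw [Finset.card_erase_of_mem hpT, hc]; rfl), sub_self,
        Finset.insert_erase hpT] at h2
      exact eq_of_sgn_mul_eq (h2.trans (mul_zero _).symm)
    · rw [cochainD_glue_of_notMem x f u hpT]
      exact hf T ((Finset.subset_insert_iff_of_notMem hpT).1 hT) hc
  refine ⟨g, fun S hS hc => ?_⟩
  rw [← hg S (hS.trans (Finset.subset_insert p A)) hc,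
    glue_of_notMem f u fun h' => hp (hS h')]

theorem acyclicAt_union {x : Fin r → R} {A : Finset (Fin r)} {ℓ : ℕ}
    (h : ∀ i < ℓ, AcyclicAt x A i) (B : Finset (Fin r)) :
    ∀ i < ℓ, AcyclicAt x (B ∪ A) i := by
  induction B using Finset.induction_on with
  | empty => simpa using h
  | insert p B _ ih =>
    rw [Finset.insert_union]
    by_cases hp : p ∈ B ∪ A
    · rwa [Finset.insert_eq_self.2 hp]
    · exact acyclicAt_insert hp ih

theorem AcyclicAt.of_union {x : Fin r → R} {A B : Finset (Fin r)} {i : ℕ}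
    (hB : ∀ p ∈ B, x p ∈ Ideal.span (x '' A)) (h : AcyclicAt x (B ∪ A) i) : AcyclicAt x A i := by
  induction B using Finset.induction_on with
  | empty => simpa using h
  | insert p B _ ih =>
    refine ih (fun q hq => hB q (Finset.mem_insert_of_mem hq)) ?_
    rw [Finset.insert_union] at h
    by_cases hp : p ∈ B ∪ A
    · rwa [Finset.insert_eq_self.2 hp] at h
    · refine AcyclicAt.of_insert hp (Ideal.span_mono (Set.image_mono ?_)
        (hB p (Finset.mem_insert_self p B))) h
      exact_mod_cast Finset.subset_union_right

/-! ### Reindexing along order embeddings, and comparison of two sequences -/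

theorem sgn_map {s : ℕ} (e : Fin r ↪o Fin s) (S : Finset (Fin r)) (j : Fin r) :
    sgn (S.map e.toEmbedding) (e j) = sgn S j := by
  unfold sgn
  rw [Finset.filter_map, Finset.card_map]
  congr 2
  ext a
  simp

theorem cochainD_map {s : ℕ} (e : Fin r ↪o Fin s) (x : Fin s → R) (f : Finset (Fin s) → R)
    (T : Finset (Fin r)) :
    cochainD x f (T.map e.toEmbedding) =
      cochainD (x ∘ e) (fun S => f (S.map e.toEmbedding)) T := by
  rw [cochainD_apply, cochainD_apply, Finset.sum_map]
  refine Finset.sum_congr rfl fun j _ => ?_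
  rw [Finset.map_erase]
  simp only [RelEmbedding.coe_toEmbedding, sgn_map, Function.comp_apply]

theorem acyclicAt_map_iff {s : ℕ} (e : Fin r ↪o Fin s) (x : Fin s → R) (i : ℕ) :
    AcyclicAt x (Finset.univ.map e.toEmbedding) i ↔ AcyclicAt (x ∘ e) Finset.univ i := by
  -- The image map on index sets is injective, so any cochain extends by zero.
  have hpre : ∀ f : Finset (Fin r) → R, ∃ F : Finset (Fin s) → R,
      (fun S => F (S.map e.toEmbedding)) = f := fun f =>
    ⟨Function.extend (Finset.map e.toEmbedding) f 0,
      funext fun S => (Finset.map_injective e.toEmbedding).extend_apply f 0 S⟩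
  have hsub : ∀ T : Finset (Fin s), T ⊆ Finset.univ.map e.toEmbedding →
      ∃ S : Finset (Fin r), S.map e.toEmbedding = T := fun T hT => by
    obtain ⟨S, _, hS⟩ := Finset.subset_map_iff.1 hT
    exact ⟨S, hS.symm⟩
  constructor
  · intro h f hf
    obtain ⟨F, rfl⟩ := hpre f
    obtain ⟨G, hG⟩ := h F fun T hT hc => by
      obtain ⟨S, rfl⟩ := hsub T hT
      rw [cochainD_map]
      exact hf S (Finset.subset_univ S) (by rwa [Finset.card_map] at hc)
    refine ⟨fun S => G (S.map e.toEmbedding), fun S _ hc => ?_⟩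
    rw [← cochainD_map]
    exact hG _ (Finset.map_subset_map.2 (Finset.subset_univ S)) (by rwa [Finset.card_map])
  · intro h F hF
    obtain ⟨g, hg⟩ := h (fun S => F (S.map e.toEmbedding)) fun T _ hc => by
      rw [← cochainD_map]
      exact hF _ (Finset.map_subset_map.2 (Finset.subset_univ T)) (by rwa [Finset.card_map])
    obtain ⟨G, rfl⟩ := hpre g
    refine ⟨G, fun S hS hc => ?_⟩
    obtain ⟨S, rfl⟩ := hsub S hS
    rw [cochainD_map]
    exact hg S (Finset.subset_univ S) (by rwa [Finset.card_map] at hc)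

/-- If the Koszul cohomology of `y` vanishes below degree `ℓ` and `(y) ⊆ (x)`, then so does that
of `x`. -/
theorem AcyclicAt.of_span_le {s : ℕ} {x : Fin r → R} {y : Fin s → R}
    (hyx : Ideal.span (Set.range y) ≤ Ideal.span (Set.range x)) {ℓ : ℕ}
    (h : ∀ i < ℓ, AcyclicAt y Finset.univ i) : ∀ i < ℓ, AcyclicAt x Finset.univ i := by
  -- Both families are blocks of the concatenation: adjoin `x` to `y`, then discard `y`, whose
  -- entries lie in `(x)`.
  have hx : Fin.append x y ∘ Fin.castAddOrderEmb s = x := funext fun k => by simp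
  have hy : Fin.append x y ∘ Fin.natAddOrderEmb r = y := funext fun k => by simp
  have h1 : ∀ i < ℓ, AcyclicAt (Fin.append x y)
      (Finset.univ.map (Fin.natAddOrderEmb r).toEmbedding) i := fun i hi => by
    rw [acyclicAt_map_iff, hy]
    exact h i hi
  intro i hi
  have h2 := acyclicAt_union h1 (Finset.univ.map (Fin.castAddOrderEmb s).toEmbedding) i hi
  rw [Finset.union_comm] at h2
  have h3 := h2.of_union fun p hp => by
    obtain ⟨k, _, rfl⟩ := Finset.mem_map.1 hp
    have himg : Fin.append x y '' (Finset.univ.map (Fin.castAddOrderEmb s).toEmbedding :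
        Finset (Fin (r + s))) = Set.range x := by
      rw [Finset.coe_map, ← Set.image_comp, Finset.coe_univ, Set.image_univ]
      exact congrArg Set.range hx
    rw [himg]
    have : Fin.append x y ((Fin.natAddOrderEmb r).toEmbedding k) = y k := congrFun hy k
    rw [this]
    exact hyx (Ideal.subset_span ⟨k, rfl⟩)
  rwa [acyclicAt_map_iff, hx] at h3

/-- If the Koszul cohomology of `x₀, …, x_r` vanishes in degree `r`, then `x_r` is a nonzerodivisor
modulo `x₀, …, x_{r-1}`. -/
theorem AcyclicAt.mem_span_of_mul_mem {x : Fin (r + 1) → R} (h : AcyclicAt x Finset.univ r) {a : R}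
    (ha : x (Fin.last r) * a ∈ Ideal.span (Set.range fun k : Fin r => x k.castSucc)) :
    a ∈ Ideal.span (Set.range fun k : Fin r => x k.castSucc) := by
  obtain ⟨b, hb⟩ := (Ideal.mem_span_range_iff_exists_fun).1 ha
  -- The syzygy `(-b, a)` encoded by the membership.
  let c : Fin (r + 1) → R := Fin.snoc (fun k => -b k) a
  have hc : ∑ j, x j * c j = 0 := by
    rw [Fin.sum_univ_castSucc]
    simp only [c, Fin.snoc_castSucc, Fin.snoc_last, ← hb]
    rw [← Finset.sum_add_distrib]
    exact Finset.sum_eq_zero fun k _ => by ring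
  -- Duality between degrees `r` and `1`: the value on the complement of `j` is `±c_j`, and the
  -- cocycle condition is the syzygy relation.
  let f : Finset (Fin (r + 1)) → R := fun S => ∑ j ∈ Sᶜ, (sgn Finset.univ j : R) * c j
  have hfe : ∀ j, f (Finset.univ.erase j) = (sgn Finset.univ j : R) * c j := fun j => by
    have : (Finset.univ.erase j)ᶜ = {j} := by ext k; simp
    simp only [f, this, Finset.sum_singleton]
  obtain ⟨g, hg⟩ := h f fun T _ hT => by
    obtain rfl : T = Finset.univ := (Finset.card_eq_iff_eq_univ T).1 (by rw [hT, Fintype.card_fin])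
    rw [cochainD_apply, ← hc]
    refine Finset.sum_congr rfl fun j _ => ?_
    rw [hfe]
    linear_combination (x j * c j) * sgn_mul_self (R := R) Finset.univ j
  -- On the complement of the last index a coboundary involves only `x₀, …, x_{r-1}`.
  have hlast := hg (Finset.univ.erase (Fin.last r)) (Finset.subset_univ _) (by
    rw [Finset.card_erase_of_mem (Finset.mem_univ _), Finset.card_univ, Fintype.card_fin]; rfl)
  have hcl : c (Fin.last r) = a := Fin.snoc_last (α := fun _ => R) _ _
  rw [hfe, hcl] at hlast
  have ha' : a = sgn Finset.univ (Fin.last r) *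
      cochainD x g (Finset.univ.erase (Fin.last r)) := by
    rw [← hlast, ← mul_assoc, sgn_mul_self, one_mul]
  rw [ha', cochainD_apply]
  refine Ideal.mul_mem_left _ _ (Ideal.sum_mem _ fun j hj => Ideal.mul_mem_right _ _
    (Ideal.mul_mem_left _ _ (Ideal.subset_span ?_)))
  obtain ⟨k, rfl⟩ := Fin.exists_castSucc_eq.2 (Finset.ne_of_mem_erase hj)
  exact ⟨k, rfl⟩

end Cochains

/-! ### Krull dimension and monomial relations -/

section Dimension

variable {R : Type u} [CommRing R]

/-- The multiplicative set of the elements `x ^ k * (1 + a * x)`. -/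
def boundary (x : R) : Submonoid R where
  carrier := {s | ∃ (k : ℕ) (a : R), s = x ^ k * (1 + a * x)}
  one_mem' := ⟨0, 0, by simp⟩
  mul_mem' := by
    rintro _ _ ⟨k, a, rfl⟩ ⟨l, b, rfl⟩
    exact ⟨k + l, a + b + a * b * x, by ring⟩

theorem mem_boundary_self (x : R) : x ∈ boundary x := ⟨1, 0, by simp⟩

theorem one_add_mem_boundary (x a : R) : 1 + a * x ∈ boundary x := ⟨0, a, by simp⟩

/-- Disjointness says that `x ∉ q` and that `q + (x)` is proper, so a maximal ideal above `q + (x)`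
is strictly larger than `q`. -/
theorem exists_isPrime_lt_of_disjoint_boundary {x : R} {q : Ideal R}
    (hq : Disjoint (boundary x : Set R) (q : Set R)) : ∃ m : Ideal R, m.IsPrime ∧ q < m := by
  have hx : x ∉ q := fun h => Set.disjoint_left.1 hq (mem_boundary_self x) h
  have hne : q ⊔ Ideal.span {x} ≠ ⊤ := by
    intro h
    obtain ⟨a, ha, b, hb, hab⟩ := Submodule.mem_sup.1 ((Ideal.eq_top_iff_one _).1 h)
    obtain ⟨c, rfl⟩ := Ideal.mem_span_singleton'.1 hb
    refine Set.disjoint_left.1 hq (one_add_mem_boundary x (-c)) ?_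
    have : (1 : R) + -c * x = a := by rw [← hab]; ring
    rw [this]
    exact ha
  obtain ⟨m, hm, hle⟩ := Ideal.exists_le_maximal _ hne
  refine ⟨m, hm.isPrime, lt_of_le_of_ne (le_sup_left.trans hle) ?_⟩
  rintro rfl
  exact hx (hle (Ideal.mem_sup_right (Ideal.mem_span_singleton_self x)))

/-- A chain of primes surviving in the localization can be prolonged by one prime in `R`; this
drives the induction on dimension. -/
theorem ringKrullDim_localization_boundary_lt {ℓ : ℕ} (h : ringKrullDim R < (ℓ + 1 : ℕ)) (x : R) :
    ringKrullDim (Localization (boundary x)) < ℓ := by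
  rw [ringKrullDim, Order.krullDim_lt_coe_iff] at h ⊢
  intro l
  let φ : PrimeSpectrum (Localization (boundary x)) → PrimeSpectrum R :=
    PrimeSpectrum.comap (algebraMap R (Localization (boundary x)))
  have hφ : StrictMono φ :=
    (IsLocalization.orderEmbedding (boundary x) (Localization (boundary x))).strictMono.comp
      fun p q h => h
  have hd : Disjoint (boundary x : Set R) ((φ l.last).asIdeal : Set R) :=
    ((IsLocalization.isPrime_iff_isPrime_disjoint (boundary x) (Localization (boundary x))
      l.last.asIdeal).1 l.last.isPrime).2
  obtain ⟨m, hm, hlt⟩ := exists_isPrime_lt_of_disjoint_boundary hd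
  have := h ((l.map φ hφ).snoc ⟨m, hm⟩ (by rw [LTSeries.last_map]; exact hlt))
  simpa using this

theorem exists_mem_mul_prod_pow_eq_sum {ℓ : ℕ} (M : Submonoid R) {x : Fin ℓ → R} {m : ℕ}
    {b : Fin ℓ → Localization M}
    (hb : (∏ i, algebraMap R (Localization M) (x i)) ^ m =
      ∑ i, b i * algebraMap R (Localization M) (x i) ^ (m + 1)) :
    ∃ s ∈ M, ∃ c : Fin ℓ → R, s * (∏ i, x i) ^ m = ∑ i, c i * x i ^ (m + 1) := by
  obtain ⟨t, ht⟩ := IsLocalization.exist_integer_multiples_of_finite M b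
  choose c hc using ht
  have heq : algebraMap R (Localization M) (t * (∏ i, x i) ^ m) =
      algebraMap R _ (∑ i, c i * x i ^ (m + 1)) := by
    simp only [map_mul, map_pow, map_prod, map_sum, hb, hc, Finset.mul_sum, Algebra.smul_def,
      mul_assoc]
  obtain ⟨s, hs⟩ := (IsLocalization.eq_iff_exists M _).1 heq
  refine ⟨s * t, (s * t).2, fun i => s * c i, ?_⟩
  rw [mul_assoc, hs, Finset.mul_sum]
  exact Finset.sum_congr rfl fun i _ => by ring

/-- If `dim R < ℓ`, then every sequence `x₁, …, x_ℓ` satisfies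
`(x₁ ⋯ x_ℓ) ^ m ∈ (x₁ ^ (m + 1), …, x_ℓ ^ (m + 1))` for some `m`. -/
theorem exists_prod_pow_mem_span {ℓ : ℕ} : ∀ {R : Type u} [CommRing R],
    ringKrullDim R < ℓ → ∀ x : Fin ℓ → R,
    ∃ (m : ℕ) (b : Fin ℓ → R), (∏ i, x i) ^ m = ∑ i, b i * x i ^ (m + 1) := by
  induction ℓ with
  | zero =>
    intro R _ h x
    have : Subsingleton R := by
      by_contra hne
      rw [not_subsingleton_iff_nontrivial] at hne
      exact absurd (ringKrullDim_nonneg_of_nontrivial (R := R)) (not_le.2 (by simpa using h))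
    exact ⟨0, 0, Subsingleton.elim _ _⟩
  | succ ℓ ih =>
    intro R _ h x
    obtain ⟨m, b, hb⟩ := ih (ringKrullDim_localization_boundary_lt h (x 0))
      fun i => algebraMap R _ (x i.succ)
    obtain ⟨_, ⟨k, a, rfl⟩, c, hrel⟩ := exists_mem_mul_prod_pow_eq_sum (boundary (x 0)) hb
    set P := ∏ i : Fin ℓ, x i.succ with hP
    have hPi : ∀ i : Fin ℓ, ∃ d, P = x i.succ * d := fun i =>
      Finset.dvd_prod_of_mem (fun i : Fin ℓ => x i.succ) (Finset.mem_univ i)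
    choose d hd using hPi
    -- Multiply `x₀^k (1 + a x₀) P^m = ∑ cᵢ xᵢ₊₁^(m+1)` by `x₀^m P^k`, use `P = xᵢ₊₁ dᵢ` on the
    -- right, and move the `a`-term across.
    refine ⟨m + k, Fin.cons (-(a * P ^ (m + k)))
      (fun i => c i * x 0 ^ m * d i ^ k), ?_⟩
    rw [Fin.prod_univ_succ, Fin.sum_univ_succ]
    simp only [Fin.cons_zero, Fin.cons_succ]
    have hterm : ∑ i : Fin ℓ, c i * x 0 ^ m * d i ^ k * x i.succ ^ (m + k + 1) =
        x 0 ^ m * P ^ k * ∑ i : Fin ℓ, c i * x i.succ ^ (m + 1) := by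
      rw [Finset.mul_sum]
      refine Finset.sum_congr rfl fun i _ => ?_
      have : P ^ k = x i.succ ^ k * d i ^ k := by rw [← mul_pow, ← hd i]
      rw [this]
      ring
    rw [hterm, ← hrel, ← hP]
    ring

/-- If a prime `p` has height less than `ℓ`, then a sequence of length `ℓ` satisfies a monomial
relation up to a factor outside `p`. -/
theorem exists_mul_prod_pow_eq_sum_of_height_lt {ℓ : ℕ} (p : Ideal R) [p.IsPrime]
    (h : p.height < ℓ) (x : Fin ℓ → R) :
    ∃ s ∉ p, ∃ (m : ℕ) (b : Fin ℓ → R), s * (∏ i, x i) ^ m = ∑ i, b i * x i ^ (m + 1) := by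
  have hdim : ringKrullDim (Localization.AtPrime p) < ℓ := by
    rw [IsLocalization.AtPrime.ringKrullDim_eq_height p]
    exact_mod_cast h
  obtain ⟨m, b, hb⟩ := exists_prod_pow_mem_span hdim fun i => algebraMap R _ (x i)
  obtain ⟨s, hs, c, hc⟩ := exists_mem_mul_prod_pow_eq_sum p.primeCompl hb
  exact ⟨s, hs, m, c, hc⟩

end Dimension

/-! ### Koszul grade -/

section Grade

variable {R : Type u} [CommRing R] {r : ℕ}

theorem linearCombination_koszulD_single (x : Fin r → R) (i : ℕ) (f : Finset (Fin r) → R)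
    (T : Sub r (i + 1)) :
    Finsupp.linearCombination R (fun S : Sub r i => f S.1) (koszulD x i (Finsupp.single T 1)) =
      cochainD x f T.1 := by
  rw [koszulD_single, map_sum, cochainD_apply,
    ← Finset.sum_coe_sort T.1 fun j => (sgn T.1 j : R) * x j * f (T.1.erase j)]
  refine Finset.sum_congr rfl fun j _ => ?_
  rw [Finsupp.linearCombination_single, one_mul, smul_eq_mul]

/-- Homomorphisms out of the free module `K_i` are functions on subsets of size `i`, which
translates exactness of the categorical complex into `AcyclicAt`. -/
theorem acyclicAt_of_not_nontrivial (x : Fin r → R) (i : ℕ)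
    (h : ¬ Nontrivial (koszulCohomology x R i)) : AcyclicAt x Finset.univ i := by
  rw [not_nontrivial_iff_subsingleton] at h
  have hex : ((koszulComplex x).linearYonedaObj R (ModuleCat.of R R)).ExactAt i := by
    rw [HomologicalComplex.exactAt_iff_isZero_homology]
    exact ModuleCat.isZero_of_subsingleton _
  intro f hf
  let φ : (koszulComplex x).X i ⟶ ModuleCat.of R R :=
    ModuleCat.ofHom (Finsupp.linearCombination R (fun S : Sub r i => f S.1))
  have hφ : (koszulComplex x).d (i + 1) i ≫ φ = 0 := by
    rw [koszulComplex_d]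
    refine ModuleCat.hom_ext (Finsupp.lhom_ext' fun T => LinearMap.ext_ring ?_)
    exact (linearCombination_koszulD_single x i f T).trans (hf T.1 (Finset.subset_univ _) T.2)
  have hφS : ∀ S : Sub r i, φ.hom (Finsupp.single S (1 : R)) = f S.1 := fun S => by
    refine (Finsupp.linearCombination_single R (1 : R) S).trans ?_
    rw [one_smul]
  cases i with
  | zero =>
    rw [HomologicalComplex.exactAt_iff' _ 0 0 1 (by simp) (by simp),
      ShortComplex.moduleCat_exact_iff] at hex
    obtain ⟨ψ, hψ⟩ : ∃ ψ : (koszulComplex x).X 0 ⟶ ModuleCat.of R R,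
        (koszulComplex x).d 0 0 ≫ ψ = φ := hex φ hφ
    -- The map into degree `0` is the default `d 0 0 = 0`, so exactness forces the cocycle to
    -- vanish.
    rw [(koszulComplex x).shape 0 0 (by simp), Limits.zero_comp] at hψ
    refine ⟨0, fun S _ hc => ?_⟩
    rw [map_zero, ← hφS ⟨S, hc⟩, ← hψ]
    rfl
  | succ i =>
    rw [HomologicalComplex.exactAt_iff' _ i (i + 1) (i + 2) (by simp) (by simp),
      ShortComplex.moduleCat_exact_iff] at hex
    obtain ⟨ψ, hψ⟩ : ∃ ψ : ModuleCat.of R (Sub r i →₀ R) ⟶ ModuleCat.of R R,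
        (koszulComplex x).d (i + 1) i ≫ ψ = φ := hex φ hφ
    rw [koszulComplex_d] at hψ
    let ψ' : (Sub r i →₀ R) →ₗ[R] R := ψ.hom
    let g : Finset (Fin r) → R := fun S =>
      if hS : S.card = i then ψ' (Finsupp.single ⟨S, hS⟩ 1) else 0
    have hg : Finsupp.linearCombination R (fun S : Sub r i => g S.1) = ψ' := by
      refine Finsupp.lhom_ext' fun S => LinearMap.ext_ring ?_
      refine (Finsupp.linearCombination_single R (1 : R) S).trans ?_
      rw [one_smul]
      exact dif_pos S.2
    refine ⟨g, fun S _ hc => ?_⟩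
    rw [← hφS ⟨S, hc⟩, ← linearCombination_koszulD_single x i g ⟨S, hc⟩, hg, ← hψ]
    rfl

theorem acyclicAt_of_lt_koszulGradeSeq (x : Fin r → R) {i : ℕ} (h : i < koszulGradeSeq x R) :
    AcyclicAt x Finset.univ i := by
  refine acyclicAt_of_not_nontrivial x i fun hn => ?_
  exact absurd (iInf₂_le (f := fun (i : ℕ) (_ : Nontrivial (koszulCohomology x R i)) => (i : ℕ∞))
    i hn) (not_le.2 h)

/-- If the ideal generated by `x` has Koszul grade at least `ℓ`, then the Koszul cohomology of `x`
vanishes below degree `ℓ`. -/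
theorem acyclicAt_of_le_koszulGrade (x : Fin r → R) {ℓ : ℕ}
    (h : ℓ ≤ koszulGrade (Ideal.span (Set.range x)) R) :
    ∀ i < ℓ, AcyclicAt x Finset.univ i := by
  intro i hi
  have hlt : (i : ℕ∞) < koszulGrade (Ideal.span (Set.range x)) R :=
    lt_of_lt_of_le (by exact_mod_cast hi) h
  simp only [koszulGrade, lt_iSup_iff] at hlt
  obtain ⟨s, y, hyx, hy⟩ := hlt
  -- The supremum need not be attained: for each degree `i`, one subideal of grade above `i`
  -- suffices.
  refine AcyclicAt.of_span_le hyx (ℓ := i + 1) (fun j hj => ?_) i i.lt_succ_self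
  exact acyclicAt_of_lt_koszulGradeSeq y
    (lt_of_le_of_lt (by exact_mod_cast Nat.lt_succ_iff.1 hj) hy)

end Grade

/-! ### Top Čech cohomology -/

section Cech

variable {R : Type u} [CommRing R]

theorem pow_mul_awayMap_mk' {a b : R} (h : a ∣ b) (c : R) (n : ℕ) :
    algebraMap R (Localization.Away b) (a ^ n) *
      awayMap h (IsLocalization.mk' _ c (⟨a ^ n, n, rfl⟩ : Submonoid.powers a)) =
      algebraMap R _ c := by
  rw [← AlgHom.commutes (awayMap h), ← map_mul, ← AlgHom.commutes (awayMap h)]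
  congr 1
  exact IsLocalization.mk'_spec' (M := Submonoid.powers a) _ c ⟨a ^ n, n, rfl⟩

/-- A Čech cochain of top degree becomes a coboundary after multiplication by an element
outside a given prime whose height is less than the length of the sequence. -/
theorem exists_smul_eq_cechD {k : ℕ} (x : Fin (k + 1) → R) (p : Ideal R) [p.IsPrime]
    (h : p.height < (k + 1 : ℕ)) (f : CechCochain x (k + 1)) :
    ∃ s ∉ p, ∃ g : CechCochain x k, cechD x k g = s • f := by
  let T₀ : Sub (k + 1) (k + 1) := ⟨Finset.univ, by simp⟩
  have hT : ∀ T : Sub (k + 1) (k + 1), T = T₀ := fun T =>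
    Subtype.ext ((Finset.card_eq_iff_eq_univ T.1).1 (by rw [T.2, Fintype.card_fin]))
  set P := ∏ j ∈ T₀.1, x j with hP
  obtain ⟨a, ⟨_, n, rfl⟩, hf⟩ := IsLocalization.exists_mk'_eq (Submonoid.powers P) (f T₀)
  -- With `f = a / P^n`, the relation for the powers `xᵢ^n` gives `s f = ∑ a bᵢ / (P /
  -- xᵢ)^(n(m+1))`, whose terms come from the localizations omitting one `xᵢ`.
  obtain ⟨s, hs, m, b, hb⟩ := exists_mul_prod_pow_eq_sum_of_height_lt p h fun i => x i ^ n
  -- The complement of `S` is a single index; its sign cancels that of the differential.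
  refine ⟨s, hs, fun S => IsLocalization.mk' _
    (∑ i ∈ S.1ᶜ, (sgn Finset.univ i : R) * (a * b i))
    (⟨(∏ j ∈ S.1, x j) ^ (n * (m + 1)), n * (m + 1), rfl⟩ :
      Submonoid.powers (∏ j ∈ S.1, x j)), ?_⟩
  funext T
  obtain rfl := hT T
  have hu : IsUnit (algebraMap R (Localization.Away P) (P ^ (n * (m + 1)))) := by
    rw [map_pow]
    exact (IsLocalization.Away.algebraMap_isUnit P).pow _
  refine hu.mul_left_cancel ?_
  have hfP : algebraMap R (Localization.Away P) (P ^ n) * f T₀ = algebraMap R _ a := by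
    rw [← hf]
    exact IsLocalization.mk'_spec' (M := Submonoid.powers P) _ a ⟨P ^ n, n, rfl⟩
  have hright : algebraMap R (Localization.Away P) (P ^ (n * (m + 1))) * (s • f) T₀ =
      algebraMap R _ (a * ∑ i, b i * (x i ^ n) ^ (m + 1)) := by
    have hpn : ∏ i, x i ^ n = P ^ n := Finset.prod_pow _ _ _
    rw [← hb, Pi.smul_apply, Algebra.smul_def, hpn, map_mul, ← hfP, ← pow_mul, mul_add, mul_one,
      pow_add]
    simp only [map_mul]
    ring
  rw [hright, cechD_apply, Finset.mul_sum, Finset.mul_sum, map_sum,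
    ← Finset.sum_coe_sort Finset.univ
      fun i => algebraMap R (Localization.Away P) (a * (b i * (x i ^ n) ^ (m + 1)))]
  refine Finset.sum_congr rfl fun j _ => ?_
  have hc : (T₀.del j).1ᶜ = {j.1} := by
    ext i
    simp [T₀]
  have hPj : P = x j.1 * ∏ i ∈ (T₀.del j).1, x i := (Finset.mul_prod_erase T₀.1 x j.2).symm
  have key := pow_mul_awayMap_mk' (Finset.prod_dvd_prod_of_subset (T₀.del j).1 T₀.1 x
    (Finset.erase_subset j.1 T₀.1)) (∑ i ∈ (T₀.del j).1ᶜ, (sgn Finset.univ i : R) * (a * b i))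
    (n * (m + 1))
  have hsum : ∑ i ∈ (T₀.del j).1ᶜ, (sgn Finset.univ i : R) * (a * b i) =
      (sgn Finset.univ j.1 : R) * (a * b j.1) := by rw [hc, Finset.sum_singleton]
  have hpow : algebraMap R (Localization.Away P) (P ^ (n * (m + 1))) =
      algebraMap R (Localization.Away P) (x j.1 ^ (n * (m + 1))) *
        algebraMap R (Localization.Away P) ((∏ i ∈ (T₀.del j).1, x i) ^ (n * (m + 1))) := by
    rw [← map_mul, ← mul_pow, ← hPj]
  have hsq : ((sgn Finset.univ j.1 : ℤ) : Localization.Away P) * (sgn Finset.univ j.1 : ℤ) = 1 :=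
    sgn_mul_self _ _
  replace key := key.trans (congrArg _ hsum)
  rw [zsmul_eq_mul, hpow, ← pow_mul]
  simp only [map_mul, map_intCast] at key ⊢
  linear_combination (algebraMap R (Localization.Away P) (x j.1 ^ (n * (m + 1))) *
    (sgn Finset.univ j.1 : ℤ)) * key + (algebraMap R (Localization.Away P) (x j.1 ^ (n * (m + 1)))
      * algebraMap R _ a * algebraMap R _ (b j.1)) * hsq

theorem not_nontrivial_localizedModule_cechCohomology {k : ℕ} (x : Fin (k + 1) → R) (p : Ideal R)
    [p.IsPrime] (h : p.height < (k + 1 : ℕ)) :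
    ¬ Nontrivial (LocalizedModule p.primeCompl (cechCohomology x (k + 1))) := by
  rw [not_nontrivial_iff_subsingleton, LocalizedModule.subsingleton_iff]
  intro z
  obtain ⟨c, rfl⟩ := (ModuleCat.epi_iff_surjective
    ((cechComplex x).homologyπ (k + 1))).1 inferInstance z
  obtain ⟨s, hs, g, hg⟩ := exists_smul_eq_cechD x p h ((cechComplex x).iCycles (k + 1) c)
  refine ⟨s, hs, ?_⟩
  have hd : (cechComplex x).d k (k + 1) = ModuleCat.ofHom (cechD x k) := 
    CochainComplex.of_d (fun i => ModuleCat.of R (CechCochain x i))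
      (fun i => ModuleCat.ofHom (cechD x i)) k
  have hsc : s • c = (cechComplex x).toCycles k (k + 1) g := by
    apply (ModuleCat.mono_iff_injective ((cechComplex x).iCycles (k + 1))).1 inferInstance
    rw [map_smul]
    refine hg.symm.trans ?_
    have := (cechComplex x).toCycles_i k (k + 1)
    rw [hd] at this
    exact (congrArg (fun φ => φ.hom g) this).symm
  rw [← map_smul, hsc]
  exact congrArg (fun φ => φ.hom g) ((cechComplex x).toCycles_comp_homologyπ k (k + 1))

/-- Height is tested at the minimal primes of `(x)`; nonvanishing of the localized top Čech
cohomology excludes height below `r` at each. -/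
theorem IsParameterSequence.le_height {r : ℕ} {x : Fin r → R} (h : IsParameterSequence x) :
    r ≤ (Ideal.span (Set.range x)).height := by
  cases r with
  | zero => simp
  | succ k =>
    rw [Ideal.height_eq_inf_minimalPrimes]
    refine le_iInf₂ fun p hp => ?_
    have : p.IsPrime := hp.1.1
    by_contra hlt
    exact not_nontrivial_localizedModule_cechCohomology x p (not_le.1 hlt)
      (h.nontrivial_localization p hp.1.2)

end Cech

end NonNoetherianCM

/-! ### The theorem -/

theorem theorem3p4 {R : Type*} [CommRing R]
    (hR : NonNoetherianCM.IsCohenMacaulayFor R {𝔞 : Ideal R | 𝔞.FG}) :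
    NonNoetherianCM.IsCohenMacaulayHM R := by
  intro r x hr hx
  have hofFn : Ideal.ofList (List.ofFn x) = Ideal.span (Set.range x) := by
    simp only [Ideal.ofList, List.mem_ofFn]
    rfl
  refine ⟨(RingTheory.Sequence.isWeaklyRegular_iff_Fin R _).2 fun i => ?_, fun htop => ?_⟩
  · have hi : i.1 < r := by simpa using i.2
    -- With indices from `0`, testing entry `i` uses the initial segment of length `i + 1`, and
    -- vanishing in degree `i`, one below its length.
    have hpar := hx (i + 1) hi (Nat.le_add_left 1 i)
    have hgr := hpar.le_height
    rw [hR _ (Submodule.fg_span (Set.finite_range _))] at hgr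
    have hac := NonNoetherianCM.acyclicAt_of_le_koszulGrade _ hgr i i.1.lt_succ_self
    have hlist : Ideal.ofList ((List.ofFn x).take i) =
        Ideal.span (Set.range fun k : Fin i.1 => x (Fin.castLE hi k.castSucc)) := by
      have : {a | a ∈ (List.ofFn x).take i} =
          Set.range fun k : Fin i.1 => x (Fin.castLE hi k.castSucc) := by
        ext a
        simp only [Set.mem_ofPred_eq, List.mem_take_iff_getElem, Set.mem_range, List.getElem_ofFn,
          List.length_ofFn]
        constructor
        · rintro ⟨k, hk, rfl⟩
          exact ⟨⟨k, (lt_min_iff.1 hk).1⟩, rfl⟩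
        · rintro ⟨k, rfl⟩
          exact ⟨k, lt_min k.2 (k.2.trans hi), rfl⟩
      rw [Ideal.ofList, this]
    rw [isSMulRegular_quotient_iff_mem_of_smul_mem, smul_eq_mul, Ideal.mul_top, hlist]
    intro a ha
    refine hac.mem_span_of_mul_mem ?_
    have hxi : (List.ofFn x)[i] = x (Fin.castLE hi (Fin.last i.1)) := List.getElem_ofFn _
    rw [hxi] at ha
    exact ha
  · rw [smul_eq_mul, Ideal.mul_top, hofFn] at htop
    exact (hx r le_rfl hr).ne_top htop.symm
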